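/- Let $1\le d<n$ be integers, and put $T_{d,k}=1/\sum_{i=1}^{k}(d+1-i)$ for $1\le k\le d$ and $J_m=\sum_{i=1}^m i$ for $m\ge 0$. The size in bits of a finite alphabet is the base-two logarithm of its cardinality. An $(n,d)$ *MLDR code* (multilevel diversity coding with regeneration) stores $d$ independent messages $M_1,\dots,M_d$ of $B_1,\dots,B_d$ bits ($B_k\ge 0$, $\sum_j B_j>0$) in $n$ nodes of capacity $\alpha$ bits each, such that (i) for every $k\in\{1,\dots,d\}$, $M_k$ can be recovered without error from the contents of any $k$ nodes, and (ii) the content of any node can be regenerated exactly from $\beta$ bits sent by each of any $d$ other nodes, where what a helper node sends is a function of its own content (which may depend on the failed node and on the set of helpers). A pair $(\bar\alpha,\bar\beta)$ is *achievable* for $(\bar B_1,\dots,\bar B_d)$ if there is such a code with $\bar B_k=B_k/\sum_jB_j$, $\bar\alpha=\alpha/\sum_jB_j$ and $\bar\beta=\beta/\sum_jB_j$. An $(n,k,d)$ *exact-repair regenerating code* is defined likewise for a single message of $B>0$ bits that can be recovered from any $k$ nodes, with normalized pair $(\alpha/B,\beta/B)$. (For $B=0$ the same definition is used, without normalization.)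 The *MBR point* of either problem is the achievable pair with the least $\bar\beta$ and, among the achievable pairs with that $\bar\beta$, the least $\bar\alpha$; a code whose own normalized pair is the MBR point is an *MBR code*. *Separate coding* encodes each $M_k$ by an $(n,k,d)$ exact-repair regenerating code of its own; node contents and helper data are the tuples of those of the $d$ codes. Let $M_1,\dots,M_d$ have any non-empty finite alphabets, not all of cardinality one, let $B_1,\dots,B_d$ be their sizes in bits, $\bar B_k=B_k/\sum_jB_j$, and $$P=(P_\alpha,P_\beta)=\Big(d\sum_{k=1}^dT_{d,k}\bar B_k,\ \sum_{k=1}^dT_{d,k}\bar B_k\Big).$$ Then: 1. Separate coding achieves $P$: for some $s\ge 1$ there are, for blocks of $s$ messages (of $sB_k$ bits, which leaves the $\bar B_k$ unchanged), $(n,k,d)$ exact-repair regenerating codes for $k=1,\dots,d$ with exactly $\alpha_k=d\,T_{d,k}\,sB_k$ and $\beta_k=T_{d,k}\,sB_k$, which are MBR codes whenever $B_k>0$, such that the MLDR code obtained from them by separate coding achieves $P$ for $(\bar B_1,\dots,\bar B_d)$. 2. For every $k\in\{1,\dots,d\}$ the MBR point of the $(n,k,d)$ exact-repair problem is $(d\,T_{d,k},T_{d,k})$.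 3. Every pair $(\bar\alpha,\bar\beta)$ that is achievable for $(\bar B_1,\dots,\bar B_d)$ satisfies $$\bar\beta\ge\sum_{k=1}^dT_{d,k}\bar B_k\quad\text{and}\quad \bar\alpha+J_{d-1}\bar\beta\ge J_d\sum_{k=1}^dT_{d,k}\bar B_k .$$ 4. $P$ is the unique point at which both of these bounds hold with equality. 5. $P$ is the MBR point of the MLDR problem with normalized message sizes $(\bar B_1,\dots,\bar B_d)$. In particular, separate coding achieves the MBR point for every MLDR problem. -/

import Mathlib

namespace MLDR

/-- The size of a finite alphabet, in bits: the base-two logarithm of its cardinality. -/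
noncomputable def bits (A : Type) : ℝ := Real.logb 2 (Nat.card A)

/-- `T_{d,k} = 1 / ∑_{i=1}^k (d + 1 - i)`. -/
noncomputable def T (d k : ℕ) : ℝ := 1 / ∑ i ∈ Finset.Icc 1 k, ((d : ℝ) + 1 - (i : ℝ))

/-- `J_d = ∑_{i=1}^d i`. -/
noncomputable def J (d : ℕ) : ℝ := ∑ i ∈ Finset.Icc 1 d, (i : ℝ)

/-- An `(n,k,d)` exact-repair regenerating code storing one message from `M` in `n` nodes, each
holding a symbol of `W`, where every helper node sends a symbol of `S`. The data sent by helper `j`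
is a function of the content of node `j`; the function may depend on the failed node `i` and
on the set `A` of helpers. The values of `dec` and `repair` at sets `A` of other sizes
are irrelevant. -/
structure RegeneratingCode (n k d : ℕ) (M W S : Type) where
  enc : Fin n → M → W
  dec : (A : Finset (Fin n)) → (A → W) → M
  help : (i : Fin n) → (A : Finset (Fin n)) → A → W → S
  repair : (i : Fin n) → (A : Finset (Fin n)) → (A → S) → W
  reconstruction : ∀ A : Finset (Fin n), A.card = k →
    ∀ m : M, dec A (fun j => enc j m) = m
  regeneration : ∀ (i : Fin n) (A : Finset (Fin n)), A.card = d → i ∉ A →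
    ∀ m : M, repair i A (fun j => help i A j (enc j m)) = enc i m

/-- An `(n,d)` code for multilevel diversity coding with regeneration. The message `M_{k+1}` of
the usual one-based numbering has alphabet `M k`, `k : Fin d`, and is recovered from any
`k + 1` nodes. The requirements hold for every tuple of messages (independent messages,
zero error). -/
structure MLDRCode (n d : ℕ) (M : Fin d → Type) (W S : Type) where
  enc : Fin n → (∀ k, M k) → W
  dec : (k : Fin d) → (A : Finset (Fin n)) → (A → W) → M k
  help : (i : Fin n) → (A : Finset (Fin n)) → A → W → S
  repair : (i : Fin n) → (A : Finset (Fin n)) → (A → S) → W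
  reconstruction : ∀ (k : Fin d) (A : Finset (Fin n)), A.card = (k : ℕ) + 1 →
    ∀ m : (∀ k, M k), dec k A (fun j => enc j m) = m k
  regeneration : ∀ (i : Fin n) (A : Finset (Fin n)), A.card = d → i ∉ A →
    ∀ m : (∀ k, M k), repair i A (fun j => help i A j (enc j m)) = enc i m

/-- Separate coding: the message with index `k` is encoded by its own regenerating code `C k`;
node contents and helper data are the tuples of those of the individual codes. -/
def separateCode {n d : ℕ} {M W S : Fin d → Type}
    (C : ∀ k : Fin d, RegeneratingCode n ((k : ℕ) + 1) d (M k) (W k) (S k)) :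
    MLDRCode n d M (∀ k, W k) (∀ k, S k) where
  enc i m := fun k => (C k).enc i (m k)
  dec k A w := (C k).dec A (fun j => w j k)
  help i A j w := fun k => (C k).help i A j (w k)
  repair i A s := fun k => (C k).repair i A (fun j => s j k)
  reconstruction k A hA m := (C k).reconstruction A hA (m k)
  regeneration i A hA hi m := funext fun k => (C k).regeneration i A hA hi (m k)

/-- The message sizes `B_k`, normalized by their sum. -/
noncomputable def normalizedSizes {d : ℕ} (M : Fin d → Type) (k : Fin d) : ℝ :=
  bits (M k) / ∑ j, bits (M j)

/-- The regenerating code `C` achieves the normalized pair `(p.1, p.2)`: it is a code for a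
message of `B > 0` bits, and its node contents and helper data fit into
`α = p.1 * B` and `β = p.2 * B` bits. -/
def RegeneratingCode.Achieves {n k d : ℕ} {M W S : Type}
    (_C : RegeneratingCode n k d M W S) (p : ℝ × ℝ) : Prop :=
  Finite M ∧ Finite W ∧ Finite S ∧ 0 < bits M ∧
    bits W ≤ p.1 * bits M ∧ bits S ≤ p.2 * bits M

/-- The MLDR code `C` achieves the normalized pair `(p.1, p.2)` for the normalized message size
tuple `Bbar`. -/
def MLDRCode.Achieves {n d : ℕ} {M : Fin d → Type} {W S : Type}
    (_C : MLDRCode n d M W S) (Bbar : Fin d → ℝ) (p : ℝ × ℝ) : Prop :=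
  (∀ k, Finite (M k) ∧ Nonempty (M k)) ∧ Finite W ∧ Finite S ∧ 0 < ∑ k, bits (M k) ∧
    (∀ k, Bbar k = normalizedSizes M k) ∧
    bits W ≤ p.1 * ∑ k, bits (M k) ∧ bits S ≤ p.2 * ∑ k, bits (M k)

/-- The achievable pairs `(ᾱ, β̄)` of the `(n,k,d)` exact-repair problem. -/
def regeneratingRegion (n k d : ℕ) : Set (ℝ × ℝ) :=
  {p | ∃ (M W S : Type) (C : RegeneratingCode n k d M W S), C.Achieves p}

/-- The achievable pairs `(ᾱ, β̄)` of the `(n,d)` MLDR problem with normalized message sizes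
`Bbar`. -/
def mldrRegion (n d : ℕ) (Bbar : Fin d → ℝ) : Set (ℝ × ℝ) :=
  {p | ∃ (M : Fin d → Type) (W S : Type) (C : MLDRCode n d M W S), C.Achieves Bbar p}

/-- `p` is the minimum-bandwidth-regenerating point of a region of pairs `(ᾱ, β̄)`: it is in the
region, it has the least `β̄`, and the least `ᾱ` among the pairs with that `β̄`. -/
def IsMBRPoint (R : Set (ℝ × ℝ)) (p : ℝ × ℝ) : Prop :=
  p ∈ R ∧ ∀ q ∈ R, p.2 ≤ q.2 ∧ (q.2 = p.2 → p.1 ≤ q.1)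

/-- `C` is an MBR code: its own normalized pair is the MBR point of the exact-repair problem. -/
def RegeneratingCode.IsMBR {n k d : ℕ} {M W S : Type}
    (C : RegeneratingCode n k d M W S) : Prop :=
  C.Achieves (bits W / bits M, bits S / bits M) ∧
    IsMBRPoint (regeneratingRegion n k d) (bits W / bits M, bits S / bits M)

/-- `∑_{k=1}^d T_{d,k} B̄_k`. -/
noncomputable def weightedSize {d : ℕ} (Bbar : Fin d → ℝ) : ℝ :=
  ∑ k : Fin d, T d ((k : ℕ) + 1) * Bbar k

end MLDR

/-! Converse: let the messages be uniformly distributed. A function of them becomes a partition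
(`Setoid`) of the message space; finer is smaller, joint knowledge is `⊓`, and `entropy` is antitone
and submodular. Keep only `d + 1` nodes, so that a failed node is helped by all the others, and sum
over all orders of the nodes. Let F(k) be the joint entropy of `K` and the repair data of `k` nodes,
and G(k) the same with the content of a further node. Two Shannon inequalities,
`repairEntropy_sub_le` and `nodeRepairEntropy_sub_le`, put the increments of G between those of F;
`increments_le` deduces that (F(j) - F(0)) / `repairCount d j` decreases.

The repair data of `k + 1` nodes determine the first `k + 1` messages, so there it does not matter
whether these messages are adjoined (`level_inequalities`). Hence the condition can be enlarged by
one message per level, which each time releases that message's entropy with weight `T`. Starting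
from F(1), bounded through β, and G(0), bounded by α, `entropy_outer_bounds` climbs the levels to
both bounds.

Achievability: product-matrix codes over rings with `q ^ t` elements meet the single-message values
exactly for every alphabet size `q`, and a common block length lets them be combined. Both bounds
are tight only at the resulting point, which makes it the MBR point. -/

namespace MLDR

/-! ### Entropy of partitions of a finite set -/

section Entropy

variable {Ω : Type} [Fintype Ω]

open Classical in
/-- The number of elements of the class of `ω`. -/
noncomputable def classSize (s : Setoid Ω) (ω : Ω) : ℝ :=
  ((Finset.univ.filter fun x => s ω x).card : ℝ)

/-- The Shannon entropy, in nats, of the class of a uniformly distributed element of `Ω`. -/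
noncomputable def entropy (s : Setoid Ω) : ℝ :=
  (∑ ω : Ω, (Real.log (Fintype.card Ω) - Real.log (classSize s ω))) / Fintype.card Ω

lemma classSize_pos (s : Setoid Ω) (ω : Ω) : 0 < classSize s ω := by
  classical
  unfold classSize
  exact_mod_cast Finset.card_pos.mpr ⟨ω, by simp⟩

lemma classSize_congr {s : Setoid Ω} {x y : Ω} (h : s x y) : classSize s x = classSize s y := by
  classical
  unfold classSize
  congr 2
  ext z
  simp only [Finset.mem_filter, Finset.mem_univ, true_and]
  exact ⟨fun hz => s.trans (s.symm h) hz, fun hz => s.trans h hz⟩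

lemma classSize_mono {s t : Setoid Ω} (h : s ≤ t) (ω : Ω) : classSize s ω ≤ classSize t ω := by
  classical
  unfold classSize
  exact_mod_cast Finset.card_le_card fun x hx => by
    simp only [Finset.mem_filter, Finset.mem_univ, true_and] at hx ⊢
    exact h hx

lemma entropy_anti {s t : Setoid Ω} (h : s ≤ t) : entropy t ≤ entropy s := by
  unfold entropy
  gcongr with ω
  · exact classSize_pos s ω
  · exact classSize_mono h ω

lemma entropy_top : entropy (⊤ : Setoid Ω) = 0 := by
  classical
  have h : ∀ ω : Ω, classSize (⊤ : Setoid Ω) ω = Fintype.card Ω := fun ω => by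
    simp [classSize, Setoid.top_def]
  simp [entropy, h]

lemma entropy_bot : entropy (⊥ : Setoid Ω) = Real.log (Fintype.card Ω) := by
  classical
  have h : ∀ ω : Ω, classSize (⊥ : Setoid Ω) ω = 1 := fun ω => by
    simp [classSize, Finset.filter_eq]
  rcases isEmpty_or_nonempty Ω with hΩ | hΩ
  · simp [entropy]
  · simp [entropy, h]

/-- Weighted count of triples (ω, x, y) with `s ω x` and `t ω y`. For fixed x, y the admissible ω
are either absent or form one class of `s ⊓ t`, and then `u x y`; so they contribute at most `1 /
classSize u x`. Summing over y leaves at most 1 for each x. -/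
lemma sum_classSize_ratio_le {s t u : Setoid Ω} (hs : s ≤ u) (ht : t ≤ u) :
    ∑ ω : Ω, classSize s ω * classSize t ω / (classSize (s ⊓ t) ω * classSize u ω)
      ≤ Fintype.card Ω := by
  classical
  have expand : ∀ ω : Ω,
      classSize s ω * classSize t ω / (classSize (s ⊓ t) ω * classSize u ω) =
        ∑ x : Ω, ∑ y : Ω,
          if s ω x ∧ t ω y then 1 / (classSize (s ⊓ t) ω * classSize u ω) else 0 := by
    intro ω
    have h1 : classSize s ω = ∑ x : Ω, if s ω x then (1 : ℝ) else 0 := by simp [classSize]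
    have h2 : classSize t ω = ∑ x : Ω, if t ω x then (1 : ℝ) else 0 := by simp [classSize]
    rw [h1, h2, Finset.sum_mul_sum, Finset.sum_div]
    refine Finset.sum_congr rfl fun x _ => ?_
    rw [Finset.sum_div]
    refine Finset.sum_congr rfl fun y _ => ?_
    by_cases hx : s ω x <;> by_cases hy : t ω y <;> simp [hx, hy]
  have inner : ∀ x y : Ω,
      (∑ ω : Ω, if s ω x ∧ t ω y then 1 / (classSize (s ⊓ t) ω * classSize u ω) else 0)
        ≤ if u x y then 1 / classSize u x else 0 := by
    intro x y
    by_cases hex : ∃ ω, s ω x ∧ t ω y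
    · obtain ⟨ω₀, hx, hy⟩ := hex
      have huxy : u x y := u.trans (u.symm (hs hx)) (ht hy)
      rw [if_pos huxy]
      have hiff : ∀ ω, (s ω x ∧ t ω y) ↔ (s ⊓ t) ω₀ ω := by
        intro ω
        change _ ↔ s ω₀ ω ∧ t ω₀ ω
        exact ⟨fun h => ⟨s.trans hx (s.symm h.1), t.trans hy (t.symm h.2)⟩,
          fun h => ⟨s.trans (s.symm h.1) hx, t.trans (t.symm h.2) hy⟩⟩
      have hterm : ∀ ω, (if s ω x ∧ t ω y then
          1 / (classSize (s ⊓ t) ω * classSize u ω) else 0) =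
          (if (s ⊓ t) ω₀ ω then 1 / (classSize (s ⊓ t) ω₀ * classSize u x) else 0) := by
        intro ω
        by_cases h : s ω x ∧ t ω y
        · rw [if_pos h, if_pos ((hiff ω).1 h), ← classSize_congr ((hiff ω).1 h),
            classSize_congr (hs h.1)]
        · rw [if_neg h, if_neg (fun h' => h ((hiff ω).2 h'))]
      simp only [hterm]
      rw [← Finset.sum_filter, Finset.sum_const, nsmul_eq_mul]
      have hp := classSize_pos (s ⊓ t) ω₀
      have hq := classSize_pos u x
      change classSize (s ⊓ t) ω₀ * _ ≤ _
      apply le_of_eq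
      field_simp
    · have : ∀ ω, ¬ (s ω x ∧ t ω y) := fun ω h => hex ⟨ω, h⟩
      simp only [this, if_false, Finset.sum_const_zero]
      split_ifs
      · exact (one_div_pos.mpr (classSize_pos u x)).le
      · exact le_rfl
  calc _ = ∑ ω : Ω, ∑ x : Ω, ∑ y : Ω,
          (if s ω x ∧ t ω y then 1 / (classSize (s ⊓ t) ω * classSize u ω) else 0) :=
        Finset.sum_congr rfl fun ω _ => expand ω
    _ = ∑ x : Ω, ∑ y : Ω, ∑ ω : Ω,
          (if s ω x ∧ t ω y then 1 / (classSize (s ⊓ t) ω * classSize u ω) else 0) := by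
        rw [Finset.sum_comm]
        exact Finset.sum_congr rfl fun x _ => Finset.sum_comm
    _ ≤ ∑ x : Ω, ∑ y : Ω, (if u x y then 1 / classSize u x else 0) :=
        Finset.sum_le_sum fun x _ => Finset.sum_le_sum fun y _ => inner x y
    _ = ∑ x : Ω, (1 : ℝ) := by
        refine Finset.sum_congr rfl fun x _ => ?_
        rw [← Finset.sum_filter, Finset.sum_const, nsmul_eq_mul]
        change classSize u x * _ = _
        have hq := classSize_pos u x
        field_simp
    _ = Fintype.card Ω := by simp

/-- Submodularity of entropy: `I(s ; t | u) ≥ 0`. -/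
lemma entropy_submodular {s t u : Setoid Ω} (hs : s ≤ u) (ht : t ≤ u) :
    entropy (s ⊓ t) + entropy u ≤ entropy s + entropy t := by
  unfold entropy
  rw [← add_div, ← add_div, ← Finset.sum_add_distrib, ← Finset.sum_add_distrib]
  refine div_le_div_of_nonneg_right ?_ (by positivity)
  rw [← sub_nonpos, ← Finset.sum_sub_distrib]
  -- `log z ≤ z - 1` at the ratio z whose sum is bounded by `sum_classSize_ratio_le`.
  have key : ∀ ω : Ω,
      (Real.log (Fintype.card Ω) - Real.log (classSize (s ⊓ t) ω) +
          (Real.log (Fintype.card Ω) - Real.log (classSize u ω))) -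
        (Real.log (Fintype.card Ω) - Real.log (classSize s ω) +
          (Real.log (Fintype.card Ω) - Real.log (classSize t ω))) ≤
      classSize s ω * classSize t ω / (classSize (s ⊓ t) ω * classSize u ω) - 1 := by
    intro ω
    have h1 := classSize_pos s ω
    have h2 := classSize_pos t ω
    have h3 := classSize_pos (s ⊓ t) ω
    have h4 := classSize_pos u ω
    have h := Real.log_le_sub_one_of_pos
      (show 0 < classSize s ω * classSize t ω / (classSize (s ⊓ t) ω * classSize u ω) by positivity)
    rw [Real.log_div (by positivity) (by positivity), Real.log_mul h1.ne' h2.ne',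
      Real.log_mul h3.ne' h4.ne'] at h
    linarith
  refine (Finset.sum_le_sum fun ω _ => key ω).trans ?_
  rw [Finset.sum_sub_distrib]
  have := sum_classSize_ratio_le hs ht
  simp only [Finset.sum_const, Finset.card_univ, nsmul_eq_mul, mul_one]
  linarith

/-- Subadditivity of conditional entropy given `c`: submodularity over `c`, one index at a time. -/
lemma entropy_inf_iInf_le {ι : Type} (c : Setoid Ω) (X : ι → Setoid Ω) (R : Finset ι) :
    entropy (c ⊓ ⨅ p ∈ R, X p) - entropy c ≤ ∑ p ∈ R, (entropy (c ⊓ X p) - entropy c) := by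
  classical
  induction R using Finset.induction_on with
  | empty => simp
  | insert a R ha ih =>
    rw [Finset.sum_insert ha, Finset.iInf_insert]
    have h := entropy_submodular (s := c ⊓ X a) (t := c ⊓ ⨅ p ∈ R, X p) (u := c)
      inf_le_left inf_le_left
    rw [← inf_inf_distrib_left] at h
    linarith

/-- Each nonempty fibre of `f` is a class and contributes exactly 1. -/
lemma sum_inv_classSize_ker {A : Type} [Finite A] (f : Ω → A) :
    ∑ ω : Ω, 1 / classSize (Setoid.ker f) ω ≤ Nat.card A := by
  classical
  have := Fintype.ofFinite A
  rw [Nat.card_eq_fintype_card, ← Finset.sum_fiberwise (s := Finset.univ) (g := f)]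
  calc _ ≤ ∑ a : A, (1 : ℝ) := by
        refine Finset.sum_le_sum fun a _ => ?_
        rcases (Finset.univ.filter fun ω => f ω = a).eq_empty_or_nonempty with h | h
        · simp [h]
        · have hc : ∀ ω ∈ Finset.univ.filter (fun ω => f ω = a),
              1 / classSize (Setoid.ker f) ω =
                1 / ((Finset.univ.filter fun ω => f ω = a).card : ℝ) := by
            intro ω hω
            simp only [Finset.mem_filter, Finset.mem_univ, true_and] at hω
            simp [classSize, Setoid.ker_def, hω, eq_comm]
          rw [Finset.sum_congr rfl hc, Finset.sum_const, nsmul_eq_mul]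
          have : (0 : ℝ) < (Finset.univ.filter fun ω => f ω = a).card := by
            exact_mod_cast h.card_pos
          apply le_of_eq
          field_simp
    _ = _ := by simp

lemma entropy_ker_le {A : Type} [Finite A] (f : Ω → A) :
    entropy (Setoid.ker f) ≤ Real.log (Nat.card A) := by
  rcases isEmpty_or_nonempty Ω with hΩ | ⟨⟨ω₀⟩⟩
  · simp only [entropy, Finset.univ_eq_empty, Finset.sum_empty, zero_div]
    exact Real.log_natCast_nonneg _
  have hΩ : (0 : ℝ) < Fintype.card Ω := by exact_mod_cast Fintype.card_pos_iff.mpr ⟨ω₀⟩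
  have hA : (0 : ℝ) < Nat.card A := by
    have : Nonempty A := ⟨f ω₀⟩
    exact_mod_cast Nat.card_pos
  unfold entropy
  rw [div_le_iff₀ hΩ]
  -- Gibbs' inequality against the uniform distribution on `A`, again through `log z ≤ z - 1`.
  have key : ∀ ω : Ω, Real.log (Fintype.card Ω) - Real.log (classSize (Setoid.ker f) ω) ≤
      Real.log (Nat.card A) +
        (Fintype.card Ω / Nat.card A * (1 / classSize (Setoid.ker f) ω) - 1) := by
    intro ω
    have h1 := classSize_pos (Setoid.ker f) ω
    have h := Real.log_le_sub_one_of_pos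
      (show 0 < (Fintype.card Ω : ℝ) / Nat.card A * (1 / classSize (Setoid.ker f) ω) by positivity)
    rw [Real.log_mul (by positivity) (by positivity), Real.log_div hΩ.ne' hA.ne',
      one_div, Real.log_inv] at h
    rw [one_div]
    linarith
  refine (Finset.sum_le_sum fun ω _ => key ω).trans ?_
  rw [Finset.sum_add_distrib, Finset.sum_sub_distrib, ← Finset.mul_sum]
  have h := mul_le_mul_of_nonneg_left (sum_inv_classSize_ker f)
    (show 0 ≤ (Fintype.card Ω : ℝ) / Nat.card A by positivity)
  rw [div_mul_cancel₀ _ hA.ne'] at h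
  simp only [Finset.sum_const, Finset.card_univ, nsmul_eq_mul, mul_one]
  linarith

end Entropy

/-! ### Shannon inequalities for the repair data, symmetrized over orders of the nodes -/

section Repair

variable {Ω : Type} {d : ℕ}

/-- All the data sent to the failed node `i`. -/
def incoming (S : Fin (d + 1) → Fin (d + 1) → Setoid Ω) (i : Fin (d + 1)) : Setoid Ω :=
  ⨅ (j) (_ : j ≠ i), S j i

/-- All the data sent to the first `k` nodes, in the order given by `π`, when they fail. -/
def incomingFirst (S : Fin (d + 1) → Fin (d + 1) → Setoid Ω) (π : Equiv.Perm (Fin (d + 1)))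
    (k : ℕ) : Setoid Ω :=
  ⨅ (p : Fin (d + 1)) (_ : (p : ℕ) < k), incoming S (π p)

variable {S : Fin (d + 1) → Fin (d + 1) → Setoid Ω}

lemma incoming_le {i j : Fin (d + 1)} (h : j ≠ i) : incoming S i ≤ S j i :=
  iInf₂_le (f := fun j (_ : j ≠ i) => S j i) j h

lemma incomingFirst_le (π : Equiv.Perm (Fin (d + 1))) {k : ℕ} {p : Fin (d + 1)}
    (h : (p : ℕ) < k) : incomingFirst S π k ≤ incoming S (π p) :=
  iInf₂_le (f := fun (p : Fin (d + 1)) (_ : (p : ℕ) < k) => incoming S (π p)) p h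

lemma incomingFirst_zero (π : Equiv.Perm (Fin (d + 1))) : incomingFirst S π 0 = ⊤ := by
  simp [incomingFirst]

lemma incomingFirst_succ (π : Equiv.Perm (Fin (d + 1))) (p : Fin (d + 1)) :
    incomingFirst S π (p + 1) = incomingFirst S π p ⊓ incoming S (π p) := by
  apply le_antisymm
  · refine le_inf (le_iInf₂ fun q hq => incomingFirst_le π (by omega)) ?_
    exact incomingFirst_le π (by omega)
  · refine le_iInf₂ fun q hq => ?_
    rcases Nat.lt_succ_iff_lt_or_eq.mp hq with h | h
    · exact inf_le_left.trans (incomingFirst_le π h)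
    · rw [Fin.ext h]
      exact inf_le_right

lemma incomingFirst_mul_swap (π : Equiv.Perm (Fin (d + 1))) {k : ℕ} {p q : Fin (d + 1)}
    (hp : k ≤ p) (hq : k ≤ q) :
    incomingFirst S (π * Equiv.swap p q) k = incomingFirst S π k := by
  unfold incomingFirst
  refine iInf_congr fun r => iInf_congr fun hr => ?_
  have h1 : r ≠ p := fun h => by omega
  have h2 : r ≠ q := fun h => by omega
  rw [Equiv.Perm.mul_apply, Equiv.swap_apply_of_ne_of_ne h1 h2]

variable [Fintype Ω]

/-- Given `K`, the joint entropy of the repair data of `k` nodes, summed over all orders. -/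
noncomputable def repairEntropy (S : Fin (d + 1) → Fin (d + 1) → Setoid Ω) (K : Setoid Ω)
    (k : ℕ) : ℝ :=
  ∑ π : Equiv.Perm (Fin (d + 1)), entropy (K ⊓ incomingFirst S π k)

/-- The joint entropy of `K`, the repair data of `k` nodes and the content of a further node,
summed over all orders. -/
noncomputable def nodeRepairEntropy (W : Fin (d + 1) → Setoid Ω)
    (S : Fin (d + 1) → Fin (d + 1) → Setoid Ω) (K : Setoid Ω) (k : ℕ) : ℝ :=
  ∑ π : Equiv.Perm (Fin (d + 1)), entropy (K ⊓ W (π (Fin.last d)) ⊓ incomingFirst S π k)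

variable {W : Fin (d + 1) → Setoid Ω}

/-- Reindexing by the swap of `p` and `q` does not touch the first `k` positions, so all later
positions are interchangeable in the sum. -/
lemma sum_entropy_incomingFirst_congr (K : Setoid Ω) (X : Fin (d + 1) → Setoid Ω) {k : ℕ}
    {p q : Fin (d + 1)} (hp : k ≤ p) (hq : k ≤ q) :
    ∑ π : Equiv.Perm (Fin (d + 1)), entropy (K ⊓ X (π p) ⊓ incomingFirst S π k) =
      ∑ π : Equiv.Perm (Fin (d + 1)), entropy (K ⊓ X (π q) ⊓ incomingFirst S π k) := by
  rw [← Equiv.sum_comp (Equiv.mulRight (Equiv.swap p q))]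
  refine Finset.sum_congr rfl fun π _ => ?_
  rw [Equiv.coe_mulRight, incomingFirst_mul_swap π hp hq, Equiv.Perm.mul_apply,
    Equiv.swap_apply_left]

/-- Moves the last repaired node to the position whose content enters `nodeRepairEntropy`, so that
the two sums can be compared order by order. -/
lemma repairEntropy_succ (K : Setoid Ω) {k : ℕ} (hk : k ≤ d) :
    repairEntropy S K (k + 1) = ∑ π : Equiv.Perm (Fin (d + 1)),
      entropy (K ⊓ incoming S (π (Fin.last d)) ⊓ incomingFirst S π k) := by
  rw [sum_entropy_incomingFirst_congr K (incoming S) (p := Fin.last d) (q := ⟨k, by omega⟩)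
    (by simpa using hk) le_rfl]
  refine Finset.sum_congr rfl fun π _ => ?_
  have h := incomingFirst_succ (S := S) π ⟨k, by omega⟩
  rw [show k + 1 = ((⟨k, by omega⟩ : Fin (d + 1)) : ℕ) + 1 from rfl, h, inf_assoc,
    inf_comm (incoming S _)]

lemma repairEntropy_zero (K : Setoid Ω) :
    repairEntropy S K 0 = (Nat.factorial (d + 1)) * entropy K := by
  simp [repairEntropy, incomingFirst_zero, Fintype.card_perm]

/-- The increments of the repair entropy are at most those with a node content in the condition. -/
lemma repairEntropy_sub_le (hrep : ∀ i, incoming S i ≤ W i) (K : Setoid Ω) {j : ℕ} (hj : j < d) :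
    repairEntropy S K (j + 2) - repairEntropy S K (j + 1) ≤
      nodeRepairEntropy W S K (j + 1) - nodeRepairEntropy W S K j := by
  rw [repairEntropy_succ K (k := j + 1) (by omega), repairEntropy_succ K (k := j) (by omega)]
  unfold nodeRepairEntropy
  rw [← Finset.sum_sub_distrib, ← Finset.sum_sub_distrib]
  refine Finset.sum_le_sum fun π _ => ?_
  set l := π (Fin.last d)
  have hU : incomingFirst S π (j + 1) ≤ incomingFirst S π j :=
    le_iInf₂ fun q hq => incomingFirst_le π (by omega)
  -- The incoming data of `l` refine its content, so conditioning on them instead leaves less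
  -- entropy in the repair data at position `j`.
  have h := entropy_submodular (s := K ⊓ incoming S l ⊓ incomingFirst S π j)
    (t := K ⊓ W l ⊓ incomingFirst S π (j + 1)) (u := K ⊓ W l ⊓ incomingFirst S π j)
    (inf_le_inf_right _ (inf_le_inf_left _ (hrep l))) (inf_le_inf_left _ hU)
  have he : K ⊓ incoming S l ⊓ incomingFirst S π j ⊓ (K ⊓ W l ⊓ incomingFirst S π (j + 1)) =
      K ⊓ incoming S l ⊓ incomingFirst S π (j + 1) := by
    apply le_antisymm
    · exact le_inf (inf_le_left.trans inf_le_left) (inf_le_right.trans inf_le_right)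
    · exact le_inf (inf_le_inf_left _ hU) (inf_le_inf_right _ (inf_le_inf_left _ (hrep l)))
  rw [he] at h
  linarith

/-- Let `c` be the condition and `I` the incoming data of `π q`. Knowing the content of a helper p
saves at least the entropy of what p sends; over the `d - q` later helpers these savings add up to
at least the entropy of `I` given `c`, which turns the factor `d - q` into `d - q - 1`. -/
lemma sum_node_increment_le (hhelp : ∀ j i, W j ≤ S j i) (hrep : ∀ i, incoming S i ≤ W i)
    (K : Setoid Ω) (π : Equiv.Perm (Fin (d + 1))) (q : Fin (d + 1)) :
    ∑ p ∈ Finset.Ioi q, (entropy (K ⊓ W (π p) ⊓ incomingFirst S π (q + 1)) -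
        entropy (K ⊓ W (π p) ⊓ incomingFirst S π q)) ≤
      ((d : ℝ) - q - 1) *
        (entropy (K ⊓ incomingFirst S π (q + 1)) - entropy (K ⊓ incomingFirst S π q)) := by
  set c := K ⊓ incomingFirst S π q with hc
  set I := incoming S (π q) with hI
  have hsucc : K ⊓ incomingFirst S π (q + 1) = c ⊓ I := by
    rw [incomingFirst_succ, hc, inf_assoc]
  have hne : ∀ p ∈ Finset.Ioi q, π p ≠ π q := fun p hp h => by
    have := π.injective h
    simp [this] at hp
  have hterm : ∀ p ∈ Finset.Ioi q, entropy (K ⊓ W (π p) ⊓ incomingFirst S π (q + 1)) -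
      entropy (K ⊓ W (π p) ⊓ incomingFirst S π q) ≤
      (entropy (c ⊓ I) - entropy c) - (entropy (c ⊓ S (π p) (π q)) - entropy c) := by
    intro p hp
    have h := entropy_submodular (s := c ⊓ I) (t := c ⊓ W (π p)) (u := c ⊓ S (π p) (π q))
      (inf_le_inf_left _ (incoming_le (hne p hp))) (inf_le_inf_left _ (hhelp _ _))
    have e1 : K ⊓ W (π p) ⊓ incomingFirst S π (q + 1) = c ⊓ I ⊓ (c ⊓ W (π p)) := by
      rw [inf_right_comm, hsucc, ← inf_inf_distrib_left, inf_assoc]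
    have e2 : K ⊓ W (π p) ⊓ incomingFirst S π q = c ⊓ W (π p) := by
      rw [inf_right_comm]
    rw [e1, e2]
    linarith
  refine (Finset.sum_le_sum hterm).trans ?_
  have hsub := entropy_inf_iInf_le c (fun p => S (π p) (π q)) (Finset.Ioi q)
  -- Helpers at earlier positions send nothing new: `c` contains their own repair data, hence
  -- determines their contents.
  have hle : c ⊓ ⨅ p ∈ Finset.Ioi q, S (π p) (π q) ≤ c ⊓ I := by
    refine le_inf inf_le_left (le_iInf₂ fun i hi => ?_)
    obtain ⟨p, rfl⟩ := π.surjective i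
    rcases lt_trichotomy p q with h | h | h
    · exact inf_le_left.trans (inf_le_right.trans ((incomingFirst_le π h).trans
        ((hrep _).trans (hhelp _ _))))
    · exact absurd (congrArg π h) hi
    · exact inf_le_right.trans (iInf₂_le (f := fun p (_ : p ∈ Finset.Ioi q) => S (π p) (π q)) p
        (Finset.mem_Ioi.mpr h))
  have hanti := entropy_anti hle
  rw [Finset.sum_sub_distrib, Finset.sum_const, Fin.card_Ioi, hsucc, nsmul_eq_mul,
    Nat.sub_sub, Nat.cast_sub (by omega)]
  push_cast
  linarith

/-- The conditional form of Han's inequality for the repair data of one node, symmetrized. -/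
lemma nodeRepairEntropy_sub_le (hhelp : ∀ j i, W j ≤ S j i) (hrep : ∀ i, incoming S i ≤ W i)
    (K : Setoid Ω) {j : ℕ} (hj : j < d) :
    ((d : ℝ) - j) * (nodeRepairEntropy W S K (j + 1) - nodeRepairEntropy W S K j) ≤
      ((d : ℝ) - j - 1) * (repairEntropy S K (j + 1) - repairEntropy S K j) := by
  have h := Finset.sum_le_sum fun π (_ : π ∈ Finset.univ) =>
    sum_node_increment_le hhelp hrep K π (⟨j, by omega⟩ : Fin (d + 1))
  rw [Finset.sum_comm, ← Finset.mul_sum, Finset.sum_sub_distrib] at h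
  refine le_trans (le_of_eq ?_) h
  have hc : ∀ p ∈ Finset.Ioi (⟨j, by omega⟩ : Fin (d + 1)),
      ∑ π : Equiv.Perm (Fin (d + 1)),
        (entropy (K ⊓ W (π p) ⊓ incomingFirst S π (j + 1)) -
          entropy (K ⊓ W (π p) ⊓ incomingFirst S π j)) =
      nodeRepairEntropy W S K (j + 1) - nodeRepairEntropy W S K j := by
    intro p hp
    have hp : j < (p : ℕ) := by simpa [Fin.lt_def] using hp
    rw [Finset.sum_sub_distrib,
      sum_entropy_incomingFirst_congr K W (p := p) (q := Fin.last d) hp (by simpa using hj),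
      sum_entropy_incomingFirst_congr K W (p := p) (q := Fin.last d) hp.le (by simpa using hj.le)]
    rfl
  rw [Finset.sum_congr rfl hc, Finset.sum_const, Fin.card_Ioi, nsmul_eq_mul,
    Nat.sub_sub, Nat.cast_sub (by simp; omega)]
  push_cast
  ring

end Repair

/-! ### The constants, and the real sequences behind the bounds -/

/-- `∑_{i=1}^k (d + 1 - i)`, the reciprocal of `T_{d,k}`. -/
noncomputable def repairCount (d k : ℕ) : ℝ := ∑ i ∈ Finset.Icc 1 k, ((d : ℝ) + 1 - (i : ℝ))

lemma repairCount_zero (d : ℕ) : repairCount d 0 = 0 := by simp [repairCount]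

lemma repairCount_succ (d k : ℕ) : repairCount d (k + 1) = repairCount d k + ((d : ℝ) - k) := by
  unfold repairCount
  rw [Finset.sum_Icc_succ_top (by omega)]
  push_cast
  ring

lemma repairCount_nonneg {d k : ℕ} (hk : k ≤ d) : 0 ≤ repairCount d k := by
  induction k with
  | zero => simp [repairCount_zero]
  | succ k ih =>
    rw [repairCount_succ]
    have : ((k + 1 : ℕ) : ℝ) ≤ d := by exact_mod_cast hk
    push_cast at this
    linarith [ih (by omega)]

lemma repairCount_succ_pos {d k : ℕ} (hk : k < d) : 0 < repairCount d (k + 1) := by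
  rw [repairCount_succ]
  have : ((k + 1 : ℕ) : ℝ) ≤ d := by exact_mod_cast hk
  push_cast at this
  linarith [repairCount_nonneg hk.le]

lemma J_succ (m : ℕ) : J (m + 1) = J m + ((m : ℝ) + 1) := by
  unfold J
  rw [Finset.sum_Icc_succ_top (by omega)]
  push_cast
  rfl

lemma J_eq (m : ℕ) : J m = (m : ℝ) * (m + 1) / 2 := by
  induction m with
  | zero => simp [J]
  | succ m ih => rw [J_succ, ih]; push_cast; ring

lemma repairCount_eq (d k : ℕ) :
    repairCount d k = (k : ℝ) * d - (k : ℝ) * (k - 1) / 2 := by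
  induction k with
  | zero => simp [repairCount_zero]
  | succ k ih => rw [repairCount_succ, ih]; push_cast; ring

lemma repairCount_self (d : ℕ) : repairCount d d = J d := by
  rw [repairCount_eq, J_eq]; ring

lemma J_pred {d : ℕ} (hd : 1 ≤ d) : J (d - 1) = J d - d := by
  obtain ⟨m, rfl⟩ : ∃ m, d = m + 1 := ⟨d - 1, by omega⟩
  rw [J_succ]
  simp

section Sequences

variable {d : ℕ} {F G : ℕ → ℝ}

/-- If the increments of `F`, weighted by `1 / (d - j)`, decrease, with the increments of `G`
in between, then `F j / repairCount d j` decreases. -/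
lemma increments_le
    (h1 : ∀ j < d, ((d : ℝ) - j) * (G (j + 1) - G j) ≤ ((d : ℝ) - j - 1) * (F (j + 1) - F j))
    (h2 : ∀ j < d, F (j + 2) - F (j + 1) ≤ G (j + 1) - G j) (j : ℕ) (hj : j < d) :
    repairCount d (j + 1) * (G (j + 1) - G j) ≤ ((d : ℝ) - j - 1) * (F (j + 1) - F 0) ∧
    repairCount d (j + 1) * (F (j + 2) - F 0) ≤ repairCount d (j + 2) * (F (j + 1) - F 0) := by
  have hjd : (j : ℝ) + 1 ≤ d := by exact_mod_cast hj
  -- The newest increment is at most its share of the total. For `j = 0` this is an equality;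
  -- otherwise it rearranges the second conclusion at `j - 1`, so both conclusions are proved in one
  -- recursion.
  have base : repairCount d (j + 1) * (F (j + 1) - F j) ≤ ((d : ℝ) - j) * (F (j + 1) - F 0) := by
    cases j with
    | zero => rw [repairCount_succ, repairCount_zero]; simp
    | succ i =>
      have h := (increments_le h1 h2 i (by omega)).2
      rw [repairCount_succ d (i + 1)] at h ⊢
      push_cast at *
      linarith
  have hG : repairCount d (j + 1) * (G (j + 1) - G j) ≤ ((d : ℝ) - j - 1) * (F (j + 1) - F 0) := by
    have hN := (repairCount_succ_pos hj).le
    have a := mul_le_mul_of_nonneg_left (h1 j hj) hN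
    have b := mul_le_mul_of_nonneg_left base (show (0 : ℝ) ≤ (d : ℝ) - j - 1 by linarith)
    have hpos : (0 : ℝ) < (d : ℝ) - j := by linarith
    refine le_of_mul_le_mul_left ?_ hpos
    linarith
  refine ⟨hG, ?_⟩
  have a := mul_le_mul_of_nonneg_left (h2 j hj) (repairCount_succ_pos hj).le
  rw [repairCount_succ d (j + 1)]
  push_cast
  linarith

end Sequences

lemma T_eq (d k : ℕ) : T d k = 1 / repairCount d k := rfl

/-! ### The outer bounds for entropies -/

section Converse

variable {Ω : Type} [Fintype Ω] {d : ℕ} {W : Fin (d + 1) → Setoid Ω}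
  {S : Fin (d + 1) → Fin (d + 1) → Setoid Ω} {K : ℕ → Setoid Ω} {α β : ℝ}

/-- The symmetrized repair data of `k + 1` nodes, given the first `k + 1` messages. -/
lemma level_inequalities (hhelp : ∀ j i, W j ≤ S j i) (hrep : ∀ i, incoming S i ≤ W i)
    (hdec : ∀ k < d, ∀ A : Finset (Fin (d + 1)), A.card = k + 1 → ⨅ i ∈ A, W i ≤ K (k + 1))
    {k : ℕ} (hk : k < d) :
    repairCount d (k + 1) * (nodeRepairEntropy W S ⊤ (k + 1) - nodeRepairEntropy W S ⊤ k) ≤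
        ((d : ℝ) - k - 1) *
          (repairEntropy S ⊤ (k + 1) - (Nat.factorial (d + 1)) * entropy (K (k + 1))) ∧
      repairCount d (k + 1) *
          (repairEntropy S ⊤ (k + 2) - (Nat.factorial (d + 1)) * entropy (K (k + 1))) ≤
        repairCount d (k + 2) *
          (repairEntropy S ⊤ (k + 1) - (Nat.factorial (d + 1)) * entropy (K (k + 1))) ∧
      (Nat.factorial (d + 1)) * entropy (K (k + 1)) ≤ repairEntropy S ⊤ (k + 1) ∧
      (Nat.factorial (d + 1)) * entropy (K (k + 1)) ≤ nodeRepairEntropy W S ⊤ k := by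
  have hU : ∀ π : Equiv.Perm (Fin (d + 1)), ∀ l, k + 1 ≤ l →
      incomingFirst S π l ≤ K (k + 1) := by
    intro π l hl
    refine le_trans (le_iInf₂ fun i hi => ?_) (hdec k hk
      ((Finset.univ.filter fun p : Fin (d + 1) => (p : ℕ) < k + 1).map π.toEmbedding) ?_)
    · simp only [Finset.mem_map, Finset.mem_filter, Finset.mem_univ, true_and] at hi
      obtain ⟨p, hp, rfl⟩ := hi
      exact (incomingFirst_le π (by omega)).trans (hrep _)
    · rw [Finset.card_map, Fin.card_filter_val_lt]
      omega
  -- Here `k` repaired nodes suffice, because the content at `Fin.last d` is that of one more node.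
  have hV : ∀ π : Equiv.Perm (Fin (d + 1)), ∀ l, k ≤ l →
      W (π (Fin.last d)) ⊓ incomingFirst S π l ≤ K (k + 1) := by
    intro π l hl
    refine le_trans (le_iInf₂ fun i hi => ?_) (hdec k hk
      ((insert (Fin.last d) (Finset.univ.filter fun p : Fin (d + 1) => (p : ℕ) < k)).map
        π.toEmbedding) ?_)
    · simp only [Finset.mem_map, Finset.mem_insert, Finset.mem_filter, Finset.mem_univ,
        true_and] at hi
      obtain ⟨p, rfl | hp, rfl⟩ := hi
      · exact inf_le_left
      · exact inf_le_right.trans ((incomingFirst_le π (by omega)).trans (hrep _))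
    · rw [Finset.card_map, Finset.card_insert_of_notMem (by simp; omega), Fin.card_filter_val_lt]
      omega
  -- Adjoining `K (k + 1)` is therefore invisible at these indices and survives only in the value at
  -- index 0.
  have hF : ∀ l, k + 1 ≤ l → repairEntropy S (K (k + 1)) l = repairEntropy S ⊤ l := by
    intro l hl
    refine Finset.sum_congr rfl fun π _ => ?_
    rw [inf_eq_right.mpr (hU π l hl), top_inf_eq]
  have hG : ∀ l, k ≤ l → nodeRepairEntropy W S (K (k + 1)) l = nodeRepairEntropy W S ⊤ l := by
    intro l hl
    refine Finset.sum_congr rfl fun π _ => ?_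
    rw [inf_assoc, inf_eq_right.mpr (hV π l hl), top_inf_eq]
  obtain ⟨h1, h2⟩ := increments_le (F := repairEntropy S (K (k + 1)))
    (G := nodeRepairEntropy W S (K (k + 1)))
    (fun j hj => nodeRepairEntropy_sub_le hhelp hrep _ hj)
    (fun j hj => repairEntropy_sub_le hrep _ hj) k hk
  rw [repairEntropy_zero, hF _ le_rfl] at h1 h2
  rw [hG _ le_rfl, hG _ (by omega)] at h1
  rw [hF _ (by omega)] at h2
  have hconst : (Nat.factorial (d + 1)) * entropy (K (k + 1)) =
      ∑ π : Equiv.Perm (Fin (d + 1)), entropy (K (k + 1)) := by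
    simp [Fintype.card_perm]
  refine ⟨h1, h2, ?_, ?_⟩
  · rw [hconst]
    exact Finset.sum_le_sum fun π _ => entropy_anti (inf_le_right.trans (hU π _ le_rfl))
  · rw [hconst]
    refine Finset.sum_le_sum fun π _ => entropy_anti ?_
    rw [top_inf_eq]
    exact hV π _ le_rfl

/-- The two outer bounds, in terms of entropies. -/
theorem entropy_outer_bounds (hd : 1 ≤ d)
    (hhelp : ∀ j i, W j ≤ S j i) (hrep : ∀ i, incoming S i ≤ W i)
    (hK : K 0 = ⊤)
    (hdec : ∀ k < d, ∀ A : Finset (Fin (d + 1)), A.card = k + 1 → ⨅ i ∈ A, W i ≤ K (k + 1))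
    (hα : ∀ i, entropy (W i) ≤ α) (hβ : ∀ j i, j ≠ i → entropy (S j i) ≤ β) :
    ∑ k ∈ Finset.range d, T d (k + 1) * (entropy (K (k + 1)) - entropy (K k)) ≤ β ∧
    J d * ∑ k ∈ Finset.range d, T d (k + 1) * (entropy (K (k + 1)) - entropy (K k)) ≤
      α + J (d - 1) * β := by
  set P : ℝ := ((Nat.factorial (d + 1) : ℕ) : ℝ) with hP
  have hPpos : 0 < P := by rw [hP]; exact_mod_cast Nat.factorial_pos _
  set F := repairEntropy S ⊤
  set G := nodeRepairEntropy W S ⊤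
  set wsum : ℕ → ℝ := fun k =>
    ∑ i ∈ Finset.range k, T d (i + 1) * (entropy (K (i + 1)) - entropy (K i)) with hwsum
  have hwsum_succ : ∀ k, wsum (k + 1) = wsum k + T d (k + 1) * (entropy (K (k + 1)) - entropy (K k)) :=
    fun k => Finset.sum_range_succ _ _
  have hwsum_zero : wsum 0 = 0 := by simp [hwsum]
  have hK0 : entropy (K 0) = 0 := by rw [hK, entropy_top]
  have hF1 : F 1 ≤ P * (d * β) := by
    have hle : ∀ i, entropy (incoming S i) ≤ d * β := by
      intro i
      have h := entropy_inf_iInf_le ⊤ (fun j => S j i) (Finset.univ.erase i)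
      simp only [top_inf_eq, entropy_top, sub_zero] at h
      have he : incoming S i = ⨅ p ∈ Finset.univ.erase i, S p i := by
        simp [incoming]
      rw [he]
      refine h.trans ((Finset.sum_le_card_nsmul _ _ β fun j hj =>
        hβ j i (Finset.ne_of_mem_erase hj)).trans (le_of_eq ?_))
      simp
    have h := Finset.sum_le_card_nsmul Finset.univ
      (fun π : Equiv.Perm (Fin (d + 1)) =>
        entropy (⊤ ⊓ incoming S (π (Fin.last d)) ⊓ incomingFirst S π 0)) (d * β)
      (fun π _ => by rw [incomingFirst_zero, inf_top_eq, top_inf_eq]; exact hle _)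
    rw [← repairEntropy_succ ⊤ (by omega), Finset.card_univ, Fintype.card_perm, nsmul_eq_mul] at h
    simpa using h
  have hG0 : G 0 ≤ P * α := by
    have h := Finset.sum_le_card_nsmul Finset.univ
      (fun π : Equiv.Perm (Fin (d + 1)) =>
        entropy (⊤ ⊓ W (π (Fin.last d)) ⊓ incomingFirst S π 0)) α
      (fun π _ => by rw [incomingFirst_zero, inf_top_eq, top_inf_eq]; exact hα _)
    rw [Finset.card_univ, Fintype.card_perm, Fintype.card_fin, nsmul_eq_mul] at h
    exact h
  have level := fun {k : ℕ} (hk : k < d) => level_inequalities (K := K) hhelp hrep hdec hk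
  have hNT : ∀ k < d, repairCount d (k + 1) * T d (k + 1) = 1 := fun k hk => by
    rw [T_eq, mul_one_div_cancel (repairCount_succ_pos hk).ne']
  have hTpos : ∀ k < d, 0 < T d (k + 1) := fun k hk => by
    rw [T_eq]; exact one_div_pos.mpr (repairCount_succ_pos hk)
  -- Invariant: the second term is the normalized entropy of the repair data given the first `k + 1`
  -- messages. One more repaired node does not increase it; enlarging the condition by the next
  -- message then moves that message's weighted entropy into `wsum`.
  have bound1 : ∀ k < d,
      P * wsum (k + 1) + T d (k + 1) * (F (k + 1) - P * entropy (K (k + 1))) ≤ P * β := by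
    intro k
    induction k with
    | zero =>
      intro hk
      have hT1 : T d (0 + 1) = 1 / d := by rw [T_eq, repairCount_succ, repairCount_zero]; simp
      have hd0 : (0 : ℝ) < d := by exact_mod_cast hd
      rw [hwsum_succ, hwsum_zero, hK0, hT1]
      have : 1 / (d : ℝ) * F 1 ≤ P * β := by
        rw [one_div, inv_mul_le_iff₀ hd0]
        linarith
      calc _ = 1 / (d : ℝ) * F 1 := by simp only [zero_add]; ring
        _ ≤ _ := this
    | succ k ih =>
      intro hk
      have h0 := ih (by omega)
      have h := (level (k := k) (by omega)).2.1
      have hT := hTpos k (by omega)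
      have hT' := hTpos (k + 1) hk
      have h' := mul_le_mul_of_nonneg_left h (mul_pos hT hT').le
      have e1 := hNT k (by omega)
      have e2 := hNT (k + 1) hk
      have a1 : T d (k + 1) * T d (k + 1 + 1) *
          (repairCount d (k + 1) * (F (k + 2) - P * entropy (K (k + 1)))) =
          T d (k + 1 + 1) * (F (k + 2) - P * entropy (K (k + 1))) := by
        linear_combination (T d (k + 1 + 1) * (F (k + 2) - P * entropy (K (k + 1)))) * e1
      have a2 : T d (k + 1) * T d (k + 1 + 1) *
          (repairCount d (k + 2) * (F (k + 1) - P * entropy (K (k + 1)))) =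
          T d (k + 1) * (F (k + 1) - P * entropy (K (k + 1))) := by
        linear_combination (T d (k + 1) * (F (k + 1) - P * entropy (K (k + 1)))) * e2
      rw [a1, a2] at h'
      rw [hwsum_succ (k + 1)]
      linarith
  -- The increment of `G` is at most `d - k - 1` times the slack `P * (β - wsum (k + 1))` left by
  -- `bound1`, and `repairCount` grows by exactly this factor.
  have bound2 : ∀ k < d,
      P * (repairCount d (k + 1) * wsum (k + 1)) + (G k - P * entropy (K (k + 1))) ≤
        P * (α + (repairCount d (k + 1) - d) * β) := by
    intro k
    induction k with
    | zero =>
      intro hk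
      have e1 := hNT 0 hk
      have hN1 : repairCount d (0 + 1) = d := by rw [repairCount_succ, repairCount_zero]; simp
      have a1 : repairCount d (0 + 1) * (0 + T d (0 + 1) * (entropy (K (0 + 1)) - 0)) =
          entropy (K (0 + 1)) := by
        linear_combination entropy (K (0 + 1)) * e1
      rw [hwsum_succ, hwsum_zero, hK0, a1, hN1]
      linarith
    | succ k ih =>
      intro hk
      have h0 := ih (by omega)
      have hb := bound1 k (by omega)
      have h := (level (k := k) (by omega)).1
      have hT := hTpos k (by omega)
      have h' := mul_le_mul_of_nonneg_left h hT.le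
      have e1 := hNT k (by omega)
      have e2 := hNT (k + 1) hk
      have hk' : ((k + 1 : ℕ) : ℝ) ≤ d := by exact_mod_cast hk.le
      push_cast at hk'
      have hb' := mul_le_mul_of_nonneg_left hb (show (0 : ℝ) ≤ (d : ℝ) - k - 1 by linarith)
      have a1 : T d (k + 1) * (repairCount d (k + 1) * (G (k + 1) - G k)) = G (k + 1) - G k := by
        linear_combination (G (k + 1) - G k) * e1
      rw [a1] at h'
      have a2 : repairCount d (k + 1 + 1) * wsum (k + 1 + 1) =
          repairCount d (k + 1 + 1) * wsum (k + 1) +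
            (entropy (K (k + 1 + 1)) - entropy (K (k + 1))) := by
        rw [hwsum_succ (k + 1)]
        linear_combination (entropy (K (k + 1 + 1)) - entropy (K (k + 1))) * e2
      rw [a2, repairCount_succ d (k + 1)]
      push_cast
      linarith
  obtain ⟨m, rfl⟩ : ∃ m, d = m + 1 := ⟨d - 1, by omega⟩
  have hlast := level (k := m) (by omega)
  constructor
  · refine le_of_mul_le_mul_left ?_ hPpos
    have h := bound1 m (by omega)
    have := mul_nonneg (hTpos m (by omega)).le (sub_nonneg.mpr hlast.2.2.1)
    linarith
  · refine le_of_mul_le_mul_left ?_ hPpos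
    have h := bound2 m (by omega)
    rw [J_pred hd]
    rw [repairCount_self] at h
    linarith [hlast.2.2.2]

end Converse

/-! ### The outer bounds for codes -/

/-- The outer bounds for any system of node contents with exact repair, where `K k` stands for
the first `k` messages. -/
lemma outer_bounds_of_repair {n d : ℕ} (hd : 1 ≤ d) (hdn : d < n) {Ω W S : Type} [Fintype Ω]
    [Finite W] [Finite S] (enc : Fin n → Ω → W)
    (help : (i : Fin n) → (A : Finset (Fin n)) → A → W → S)
    (repair : (i : Fin n) → (A : Finset (Fin n)) → (A → S) → W)
    (hreg : ∀ (i : Fin n) (A : Finset (Fin n)), A.card = d → i ∉ A →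
      ∀ m, repair i A (fun j => help i A j (enc j m)) = enc i m)
    (K : ℕ → Setoid Ω) (hK : K 0 = ⊤)
    (hdec : ∀ k < d, ∀ A : Finset (Fin n), A.card = k + 1 → ∀ x y : Ω,
      (∀ i ∈ A, enc i x = enc i y) → K (k + 1) x y) :
    ∑ k ∈ Finset.range d, T d (k + 1) * (entropy (K (k + 1)) - entropy (K k)) ≤
        Real.log (Nat.card S) ∧
      J d * ∑ k ∈ Finset.range d, T d (k + 1) * (entropy (K (k + 1)) - entropy (K k)) ≤
        Real.log (Nat.card W) + J (d - 1) * Real.log (Nat.card S) := by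
  classical
  set e : Fin (d + 1) ↪ Fin n := Fin.castLEEmb hdn with he
  set H : Fin (d + 1) → Finset (Fin n) := fun i => (Finset.univ.erase i).map e with hH
  have hmem : ∀ {i j : Fin (d + 1)}, j ≠ i → e j ∈ H i := fun {i j} hji => by
    simp [hH, hji]
  have hcard : ∀ i, (H i).card = d := fun i => by simp [hH]
  have hnot : ∀ i, e i ∉ H i := fun i => by simp [hH]
  -- A node sends nothing to itself: the diagonal value `⊤` does not enter `incoming`.
  refine entropy_outer_bounds (W := fun i => Setoid.ker (enc (e i)))
    (S := fun j i => if h : j ≠ i then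
      Setoid.ker (fun ω => help (e i) (H i) ⟨e j, hmem h⟩ (enc (e j) ω)) else ⊤)
    hd ?_ ?_ hK ?_ ?_ ?_
  · intro j i
    by_cases h : j ≠ i
    · rw [dif_pos h]
      intro x y hxy
      exact congrArg (help (e i) (H i) ⟨e j, hmem h⟩) hxy
    · rw [dif_neg h]
      exact le_top
  · intro i x y hxy
    change enc (e i) x = enc (e i) y
    rw [← hreg (e i) (H i) (hcard i) (hnot i) x, ← hreg (e i) (H i) (hcard i) (hnot i) y]
    congr 1
    funext ⟨j, hj⟩
    obtain ⟨j, hj', rfl⟩ := Finset.mem_map.mp hj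
    have hji := Finset.ne_of_mem_erase hj'
    have h := incoming_le hji hxy
    rw [dif_pos hji] at h
    exact h
  · intro k hk A hA x y hxy
    refine hdec k hk (A.map e) (by simpa using hA) x y fun i hi => ?_
    obtain ⟨j, hj, rfl⟩ := Finset.mem_map.mp hi
    exact iInf₂_le (f := fun j (_ : j ∈ A) => Setoid.ker (enc (e j))) j hj hxy
  · intro i
    exact entropy_ker_le _
  · intro j i hji
    rw [dif_pos hji]
    exact entropy_ker_le _

lemma bits_nonneg (A : Type) : 0 ≤ bits A :=
  div_nonneg (Real.log_natCast_nonneg _) (Real.log_nonneg (by norm_num))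

lemma log_card_eq (A : Type) : Real.log (Nat.card A) = Real.log 2 * bits A := by
  have : Real.log 2 ≠ 0 := (Real.log_pos (by norm_num)).ne'
  unfold bits Real.logb
  field_simp

/-- Agreement of the first `k` messages. -/
def messagesBefore {d : ℕ} (M : Fin d → Type) (k : ℕ) : Setoid (∀ l, M l) where
  r x y := ∀ l : Fin d, (l : ℕ) < k → x l = y l
  iseqv := ⟨fun _ _ _ => rfl, fun h l hl => (h l hl).symm,
    fun h h' l hl => (h l hl).trans (h' l hl)⟩

/-- A class fixes the first `k` coordinates and leaves the others free, so all classes have the same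
size. -/
lemma entropy_messagesBefore {d : ℕ} (M : Fin d → Type) [∀ l, Fintype (M l)]
    [∀ l, Nonempty (M l)] (k : ℕ) :
    entropy (messagesBefore M k) =
      ∑ l : Fin d, if (l : ℕ) < k then Real.log (Fintype.card (M l)) else 0 := by
  classical
  have hpos : ∀ l, (Fintype.card (M l) : ℝ) ≠ 0 := fun l => by
    exact_mod_cast Fintype.card_ne_zero
  have hsize : ∀ ω : ∀ l, M l, classSize (messagesBefore M k) ω =
      ∏ l : Fin d, if (l : ℕ) < k then 1 else (Fintype.card (M l) : ℝ) := by
    intro ω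
    have hset : (Finset.univ.filter fun x => messagesBefore M k ω x) =
        Fintype.piFinset fun l : Fin d => if (l : ℕ) < k then {ω l} else Finset.univ := by
      ext x
      simp only [Finset.mem_filter, Finset.mem_univ, true_and, Fintype.mem_piFinset]
      refine forall_congr' fun l => ?_
      by_cases hl : (l : ℕ) < k <;> simp [hl, eq_comm]
    unfold classSize
    rw [hset, Fintype.card_piFinset]
    push_cast
    refine Finset.prod_congr rfl fun l _ => ?_
    split_ifs <;> simp
  have hN : ((Fintype.card (∀ l, M l) : ℕ) : ℝ) ≠ 0 := by exact_mod_cast Fintype.card_ne_zero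
  unfold entropy
  simp only [hsize, Finset.sum_const, Finset.card_univ, nsmul_eq_mul]
  rw [mul_div_cancel_left₀ _ hN, Fintype.card_pi, Nat.cast_prod,
    Real.log_prod (fun l _ => hpos l), Real.log_prod (fun l _ => by split_ifs <;> simp [hpos]),
    ← Finset.sum_sub_distrib]
  refine Finset.sum_congr rfl fun l _ => ?_
  split_ifs <;> simp

/-- The outer bounds for an MLDR code. -/
lemma MLDRCode.outer_bounds {n d : ℕ} (hd : 1 ≤ d) (hdn : d < n) {M : Fin d → Type} {W S : Type}
    [∀ l, Finite (M l)] [∀ l, Nonempty (M l)] [Finite W] [Finite S] (C : MLDRCode n d M W S) :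
    ∑ k : Fin d, T d (k + 1) * bits (M k) ≤ bits S ∧
      J d * ∑ k : Fin d, T d (k + 1) * bits (M k) ≤ bits W + J (d - 1) * bits S := by
  classical
  have := fun l => Fintype.ofFinite (M l)
  have h := outer_bounds_of_repair hd hdn C.enc C.help C.repair C.regeneration (messagesBefore M)
    (by
      apply eq_top_iff.mpr
      intro x y _ l hl
      exact absurd hl (Nat.not_lt_zero _))
    (by
      intro k hk A hA x y hxy l hl
      -- Decoding is specified for exactly `l + 1` nodes, hence the smaller set.
      obtain ⟨A', hA', hcard⟩ := Finset.exists_subset_card_eq (s := A) (n := (l : ℕ) + 1) (by omega)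
      rw [← C.reconstruction l A' hcard x, ← C.reconstruction l A' hcard y]
      congr 1
      funext j
      exact hxy j (hA' j.2))
  have hsum : ∑ k ∈ Finset.range d, T d (k + 1) *
      (entropy (messagesBefore M (k + 1)) - entropy (messagesBefore M k)) =
      Real.log 2 * ∑ k : Fin d, T d (k + 1) * bits (M k) := by
    rw [Finset.sum_range, Finset.mul_sum]
    refine Finset.sum_congr rfl fun k _ => ?_
    rw [entropy_messagesBefore, entropy_messagesBefore, ← Finset.sum_sub_distrib,
      Finset.sum_eq_single k]
    · rw [if_pos (by omega), if_neg (by omega), ← Nat.card_eq_fintype_card, log_card_eq]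
      ring
    · intro l _ hl
      have : (l : ℕ) ≠ k := fun h => hl (Fin.ext h)
      by_cases h : (l : ℕ) < k
      · rw [if_pos (by omega), if_pos h, sub_self]
      · rw [if_neg (by omega), if_neg h, sub_self]
    · simp
  rw [hsum, log_card_eq, log_card_eq] at h
  have h2 : (0 : ℝ) < Real.log 2 := Real.log_pos (by norm_num)
  refine ⟨le_of_mul_le_mul_left h.1 h2, le_of_mul_le_mul_left ?_ h2⟩
  linarith [h.2]

/-- The outer bounds for a regenerating code. -/
lemma RegeneratingCode.outer_bounds {n d : ℕ} (hd : 1 ≤ d) (hdn : d < n) {k : Fin d}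
    {M W S : Type} [Finite M] [Finite W] [Finite S] (C : RegeneratingCode n (k + 1) d M W S) :
    T d (k + 1) * bits M ≤ bits S ∧
      J d * (T d (k + 1) * bits M) ≤ bits W + J (d - 1) * bits S := by
  classical
  have := Fintype.ofFinite M
  -- A single message is the multilevel case with all other levels trivial: `K` jumps once, leaving
  -- one term of the weighted sum.
  set K : ℕ → Setoid M := fun l => if l ≤ k then ⊤ else ⊥ with hK
  have h := outer_bounds_of_repair hd hdn C.enc C.help C.repair C.regeneration K
    (by simp [hK])
    (by
      intro l hl A hA x y hxy
      change (if l + 1 ≤ (k : ℕ) then ⊤ else ⊥ : Setoid M) x y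
      by_cases hlk : l + 1 ≤ (k : ℕ)
      · rw [if_pos hlk]
        trivial
      · rw [if_neg hlk]
        obtain ⟨A', hA', hcard⟩ :=
          Finset.exists_subset_card_eq (s := A) (n := (k : ℕ) + 1) (by omega)
        change x = y
        rw [← C.reconstruction A' hcard x, ← C.reconstruction A' hcard y]
        congr 1
        funext j
        exact hxy j (hA' j.2))
  have hsum : ∑ l ∈ Finset.range d, T d (l + 1) * (entropy (K (l + 1)) - entropy (K l)) =
      Real.log 2 * (T d (k + 1) * bits M) := by
    rw [Finset.sum_eq_single (k : ℕ)]
    · simp only [hK]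
      rw [if_neg (by omega), if_pos le_rfl, entropy_top, entropy_bot, ← Nat.card_eq_fintype_card,
        log_card_eq]
      ring
    · intro l _ hl
      have : K (l + 1) = K l := by
        simp only [hK]
        by_cases h : l ≤ k
        · rw [if_pos (by omega), if_pos h]
        · rw [if_neg (by omega), if_neg h]
      rw [this, sub_self, mul_zero]
    · intro hk
      exact absurd (Finset.mem_range.mpr k.2) hk
  rw [hsum, log_card_eq, log_card_eq] at h
  have h2 : (0 : ℝ) < Real.log 2 := Real.log_pos (by norm_num)
  refine ⟨le_of_mul_le_mul_left h.1 h2, le_of_mul_le_mul_left ?_ h2⟩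
  linarith [h.2]

/-! ### Product-matrix codes over rings of prescribed size -/

section Construction

/-- For every `q ≠ 0` and `t ≥ n` there is a commutative ring with `q ^ t` elements that contains
`n` elements whose pairwise differences are units. -/
lemma exists_commRing_isUnit_sub {n t : ℕ} (ht : t ≠ 0) (hnt : n ≤ t) (q : ℕ) (hq : q ≠ 0) :
    ∃ (R : Type) (_ : CommRing R) (_ : Finite R) (x : Fin n → R), Nat.card R = q ^ t ∧
      ∀ i j, i ≠ j → IsUnit (x i - x j) := by
  induction q using Nat.recOnMul with
  | zero => exact absurd rfl hq
  | one => exact ⟨PUnit, inferInstance, inferInstance, fun _ => 0, by simp,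
      fun _ _ _ => isUnit_of_subsingleton _⟩
  | prime p hp =>
    have : Fact p.Prime := ⟨hp⟩
    have hcard := GaloisField.card p t ht
    have hfin : Finite (GaloisField p t) :=
      Nat.finite_of_card_ne_zero (by rw [hcard]; exact pow_ne_zero _ hp.ne_zero)
    have := Fintype.ofFinite (GaloisField p t)
    obtain ⟨x⟩ : Nonempty (Fin n ↪ GaloisField p t) := by
      apply Function.Embedding.nonempty_of_card_le
      rw [Fintype.card_fin, ← Nat.card_eq_fintype_card, hcard]
      exact hnt.trans (Nat.lt_pow_self hp.one_lt).le
    exact ⟨GaloisField p t, inferInstance, hfin, x, hcard, fun i j hij =>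
      (sub_ne_zero.mpr (x.injective.ne hij)).isUnit⟩
  -- Products of rings, with points taken coordinatewise, reach sizes that are not prime powers;
  -- differences remain units.
  | mul a b iha ihb =>
    obtain ⟨R, _, _, x, hR, hx⟩ := iha (left_ne_zero_of_mul hq)
    obtain ⟨R', _, _, y, hR', hy⟩ := ihb (right_ne_zero_of_mul hq)
    exact ⟨R × R', inferInstance, inferInstance, fun i => (x i, y i),
      by rw [Nat.card_prod, hR, hR', mul_pow],
      fun i j hij => Prod.isUnit_iff.mpr ⟨hx i j hij, hy i j hij⟩⟩

variable {R : Type} [CommRing R] {n : ℕ} {x : Fin n → R}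

/-- The Vandermonde determinant is a product of unit differences, so interpolation works although
`R` need not be a field. -/
lemma eq_zero_of_sum_pow_mul_eq_zero (hx : ∀ i j, i ≠ j → IsUnit (x i - x j))
    (A : Finset (Fin n)) (c : ℕ → R)
    (h : ∀ i ∈ A, ∑ r ∈ Finset.range A.card, x i ^ r * c r = 0) {r : ℕ} (hr : r < A.card) :
    c r = 0 := by
  classical
  set e := A.equivFin.symm
  set V := Matrix.vandermonde fun a : Fin A.card => x (e a) with hV
  have hdet : IsUnit V.det := by
    rw [hV, Matrix.det_vandermonde]
    refine IsUnit.prod_iff.mpr fun i _ => IsUnit.prod_iff.mpr fun j hj => hx _ _ fun he => ?_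
    have := e.injective (Subtype.ext he)
    simp [this] at hj
  have hmul : V.mulVec (fun a => c a) = V.mulVec 0 := by
    rw [Matrix.mulVec_zero]
    funext a
    have := h (e a) (e a).2
    rw [Finset.sum_range] at this
    exact this
  exact congrFun (Matrix.mulVec_injective_of_isUnit ((Matrix.isUnit_iff_isUnit_det V).mpr hdet)
    hmul) ⟨r, hr⟩

/-- The positions `(a, a + b)`, `a < k`, on and above the diagonal of a `d × d` matrix. -/
abbrev MessageIndex (k d : ℕ) : Type := Σ a : Fin k, Fin (d - a)

/-- The entry in row `a` and column `b`, `a ≤ b`, of the symmetric `d × d` matrix that has the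
message `m` in its first `k` rows and zeros outside its first `k` rows and columns. -/
def upperEntry {k d : ℕ} (m : MessageIndex k d → R) (a b : ℕ) : R :=
  if h : a < k ∧ a ≤ b ∧ b < d then
    m ⟨⟨a, h.1⟩, ⟨b - a, Nat.sub_lt_sub_right h.2.1 h.2.2⟩⟩
  else 0

/-- The entries of the symmetric matrix given by `upperEntry`. -/
def messageEntry {k d : ℕ} (m : MessageIndex k d → R) (a b : ℕ) : R :=
  upperEntry m (min a b) (max a b)

lemma messageEntry_comm {k d : ℕ} (m : MessageIndex k d → R) (a b : ℕ) :
    messageEntry m a b = messageEntry m b a := by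
  rw [messageEntry, min_comm, max_comm, messageEntry]

lemma messageEntry_eq_zero {k d : ℕ} (m : MessageIndex k d → R) {a b : ℕ} (ha : k ≤ a)
    (hb : k ≤ b) : messageEntry m a b = 0 :=
  dif_neg fun h => by omega

lemma eq_of_messageEntry_eq {k d : ℕ} {m m' : MessageIndex k d → R}
    (h : ∀ a < d, ∀ b < d, messageEntry m a b = messageEntry m' a b) : m = m' := by
  funext ⟨a, b⟩
  have ha := a.2
  have hb := b.2
  have key : ∀ m : MessageIndex k d → R, messageEntry m a (a + b) = m ⟨a, b⟩ := by
    intro m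
    have h1 : min (a : ℕ) (a + b) = a := by omega
    have h2 : max (a : ℕ) (a + b) = a + b := by omega
    rw [messageEntry, h1, h2, upperEntry, dif_pos ⟨a.2, by omega, by omega⟩]
    exact congrArg (fun b => m ⟨a, b⟩) (Fin.ext (by simp))
  rw [← key m, ← key m']
  exact h _ (by omega) _ (by omega)

/-- The content of node `i` in the product-matrix code. -/
def nodeContent {k d : ℕ} (x : Fin n → R) (i : Fin n) (m : MessageIndex k d → R) (b : Fin d) : R :=
  ∑ a ∈ Finset.range d, x i ^ a * messageEntry m a b

/-- A column `b ≥ k` has only `k` unknown entries, so `k` nodes determine it. By symmetry the rows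
from `k` on are then known in the remaining columns too, which again have only `k` unknowns. -/
lemma nodeContent_reconstruction {k d : ℕ} (hk : k ≤ d)
    (hx : ∀ i j, i ≠ j → IsUnit (x i - x j)) {A : Finset (Fin n)} (hA : A.card = k)
    {m m' : MessageIndex k d → R} (h : ∀ i ∈ A, nodeContent x i m = nodeContent x i m') :
    m = m' := by
  set D : ℕ → ℕ → R := fun a b => messageEntry m a b - messageEntry m' a b with hD
  have hDcomm : ∀ a b, D a b = D b a := fun a b => by
    simp only [hD, messageEntry_comm _ a b]
  have hsum : ∀ i ∈ A, ∀ b < d, ∑ a ∈ Finset.range d, x i ^ a * D a b = 0 := by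
    intro i hi b hb
    simp only [hD, mul_sub, Finset.sum_sub_distrib]
    exact sub_eq_zero.mpr (congrFun (h i hi) ⟨b, hb⟩)
  have column : ∀ b < d, (∀ a, k ≤ a → a < d → D a b = 0) → ∀ a < d, D a b = 0 := by
    intro b hb hzero a ha
    rcases le_or_gt k a with hka | hka
    · exact hzero a hka ha
    · refine eq_zero_of_sum_pow_mul_eq_zero hx A (fun a => D a b) (fun i hi => ?_)
        (hA.symm ▸ hka)
      rw [hA, ← hsum i hi b hb]
      refine Finset.sum_subset (Finset.range_mono hk) fun r hr hr' => ?_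
      rw [hzero r (by simpa using hr') (by simpa using hr), mul_zero]
  have hright : ∀ b, k ≤ b → b < d → ∀ a < d, D a b = 0 := fun b hkb hb =>
    column b hb fun a hka _ => by
      simp only [hD, messageEntry_eq_zero _ hka hkb, sub_self]
  refine eq_of_messageEntry_eq fun a ha b hb => sub_eq_zero.mp ?_
  exact column b hb (fun a hka ha => (hDcomm a b).trans (hright a hka ha b hb)) a ha

/-- With ψ_i the row of powers of `x i` and Φ the message matrix, helper j sends ψ_j Φ ψ_iᵀ. By
interpolation `d` such values determine Φ ψ_iᵀ, which by symmetry of Φ is the transposed content of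
node `i`. -/
lemma nodeContent_regeneration {k d : ℕ}
    (hx : ∀ i j, i ≠ j → IsUnit (x i - x j)) {A : Finset (Fin n)} (hA : A.card = d) (i : Fin n)
    {m m' : MessageIndex k d → R}
    (h : ∀ j ∈ A, ∑ b : Fin d, nodeContent x j m b * x i ^ (b : ℕ) =
      ∑ b : Fin d, nodeContent x j m' b * x i ^ (b : ℕ)) :
    nodeContent x i m = nodeContent x i m' := by
  set D : ℕ → ℕ → R := fun a b => messageEntry m a b - messageEntry m' a b with hD
  have hrow : ∀ a < d, ∑ b ∈ Finset.range d, x i ^ b * D a b = 0 := by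
    intro a ha
    refine eq_zero_of_sum_pow_mul_eq_zero hx A (fun a => ∑ b ∈ Finset.range d, x i ^ b * D a b)
      (fun j hj => ?_) (hA.symm ▸ ha)
    have hj := sub_eq_zero.mpr (h j hj)
    rw [← Finset.sum_sub_distrib] at hj
    rw [hA, ← hj]
    simp only [Finset.mul_sum]
    rw [Finset.sum_comm, Finset.sum_range]
    refine Finset.sum_congr rfl fun b _ => ?_
    rw [← sub_mul]
    unfold nodeContent
    rw [← Finset.sum_sub_distrib, Finset.sum_mul]
    refine Finset.sum_congr rfl fun a _ => ?_
    simp only [hD]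
    ring
  funext a
  refine sub_eq_zero.mp ?_
  rw [← hrow a a.2]
  unfold nodeContent
  rw [← Finset.sum_sub_distrib]
  refine Finset.sum_congr rfl fun b _ => ?_
  simp only [hD]
  rw [messageEntry_comm m a b, messageEntry_comm m' a b]
  ring

/-- A regenerating code exists as soon as node contents determine the message and helper data
determine the content of the failed node. -/
noncomputable def RegeneratingCode.ofDetermines {n k d : ℕ} {M W S : Type} [Nonempty M]
    (enc : Fin n → M → W) (help : (i : Fin n) → (A : Finset (Fin n)) → A → W → S)
    (hdec : ∀ A : Finset (Fin n), A.card = k → ∀ m m',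
      (∀ i ∈ A, enc i m = enc i m') → m = m')
    (hrep : ∀ (i : Fin n) (A : Finset (Fin n)), A.card = d → i ∉ A → ∀ m m',
      (∀ j : A, help i A j (enc j m) = help i A j (enc j m')) → enc i m = enc i m') :
    RegeneratingCode n k d M W S where
  enc := enc
  dec A := Function.invFun fun m (j : A) => enc j m
  help := help
  repair i A s := enc i (Function.invFun (fun m (j : A) => help i A j (enc j m)) s)
  reconstruction A hA m := hdec A hA _ _ fun i hi =>
    congrFun (Function.invFun_eq (f := fun m (j : A) => enc j m) ⟨m, rfl⟩) ⟨i, hi⟩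
  regeneration i A hA hi m := hrep i A hA hi _ _ fun j =>
    congrFun (Function.invFun_eq (f := fun m (j : A) => help i A j (enc j m)) ⟨m, rfl⟩) j

/-- The number of symbols of a message of the product-matrix code. -/
def messageLength (k d : ℕ) : ℕ := ∑ a : Fin k, (d - a)

lemma cast_messageLength {k d : ℕ} (hk : k ≤ d) : (messageLength k d : ℝ) = repairCount d k := by
  induction k with
  | zero => simp [messageLength, repairCount_zero]
  | succ k ih =>
    have h : messageLength (k + 1) d = messageLength k d + (d - k) := Fin.sum_univ_castSucc _
    rw [h, repairCount_succ, Nat.cast_add, ih (by omega), Nat.cast_sub (by omega)]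

/-- Since the ring has `Nat.card Q ^ t` elements, blocks over `Q` and message matrices are
equinumerous; any bijection transports the code, so `Q` needs no structure. -/
lemma exists_productMatrixCode {n k d t : ℕ} (hk : k ≤ d) (ht : t ≠ 0) (hnt : n ≤ t) (Q : Type)
    [Finite Q] [Nonempty Q] :
    ∃ (W S : Type) (_ : RegeneratingCode n k d (Fin (t * messageLength k d) → Q) W S),
      Finite W ∧ Finite S ∧ Nat.card W = Nat.card Q ^ (d * t) ∧ Nat.card S = Nat.card Q ^ t := by
  obtain ⟨R, _, _, x, hR, hx⟩ := exists_commRing_isUnit_sub ht hnt (Nat.card Q) Nat.card_pos.ne'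
  have hcard : Nat.card (Fin (t * messageLength k d) → Q) = Nat.card (MessageIndex k d → R) := by
    rw [Nat.card_fun, Nat.card_fun, hR, Nat.card_fin, ← pow_mul, Nat.card_sigma]
    simp [messageLength]
  obtain ⟨e⟩ := Finite.card_eq.mp hcard
  refine ⟨Fin d → R, R, RegeneratingCode.ofDetermines (fun i m => nodeContent x i (e m))
    (fun i _ _ w => ∑ b : Fin d, w b * x i ^ (b : ℕ)) ?_ ?_, inferInstance, inferInstance, ?_, hR⟩
  · exact fun A hA m m' h => e.injective (nodeContent_reconstruction hk hx hA h)
  · exact fun i A hA _ m m' h => nodeContent_regeneration hx hA i fun j hj => h ⟨j, hj⟩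
  · rw [Nat.card_fun, hR, Nat.card_fin, ← pow_mul, mul_comm]

end Construction

/-! ### MBR points and separate coding -/

lemma bits_fun (s : ℕ) (Q : Type) : bits (Fin s → Q) = s * bits Q := by
  unfold bits
  rw [Nat.card_fun, Nat.card_fin, Nat.cast_pow, Real.logb_pow]

lemma bits_pi {ι : Type} [Fintype ι] (A : ι → Type) [∀ i, Finite (A i)] [∀ i, Nonempty (A i)] :
    bits (∀ i, A i) = ∑ i, bits (A i) := by
  unfold bits
  rw [Nat.card_pi, Nat.cast_prod, Real.logb_prod]
  intro i _
  exact_mod_cast Nat.card_pos.ne'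

lemma bits_pos (A : Type) [Finite A] [Nontrivial A] : 0 < bits A :=
  Real.logb_pos (by norm_num) (by exact_mod_cast Finite.one_lt_card)

lemma exists_code_of_bits {n d s t : ℕ} (k : Fin d) (ht : t ≠ 0) (hnt : n ≤ t)
    (hs : s = t * messageLength (k + 1) d) (Q : Type) [Finite Q] [Nonempty Q] :
    ∃ (W S : Type) (_ : RegeneratingCode n (k + 1) d (Fin s → Q) W S),
      Finite W ∧ Finite S ∧ Nonempty W ∧ Nonempty S ∧
      bits W = d * T d (k + 1) * bits (Fin s → Q) ∧ bits S = T d (k + 1) * bits (Fin s → Q) := by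
  subst hs
  obtain ⟨W, S, C, hW, hS, hcW, hcS⟩ := exists_productMatrixCode (k := k + 1) k.2 ht hnt Q
  have hQ : Nat.card Q ≠ 0 := Nat.card_pos.ne'
  have hN := repairCount_succ_pos k.2
  refine ⟨W, S, C, hW, hS, (Nat.card_ne_zero.mp (by rw [hcW]; exact pow_ne_zero _ hQ)).1,
    (Nat.card_ne_zero.mp (by rw [hcS]; exact pow_ne_zero _ hQ)).1, ?_, ?_⟩
  · rw [bits_fun, Nat.cast_mul, cast_messageLength k.2, T_eq]
    unfold bits
    rw [hcW, Nat.cast_pow, Real.logb_pow]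
    push_cast
    field_simp
  · rw [bits_fun, Nat.cast_mul, cast_messageLength k.2, T_eq]
    unfold bits
    rw [hcS, Nat.cast_pow, Real.logb_pow]
    field_simp

/-- A point of a region that meets two bounds with equality is its MBR point. -/
lemma isMBRPoint_of_outer_bounds {d : ℕ} (hd : 1 ≤ d) {X : Set (ℝ × ℝ)} {c : ℝ}
    (hmem : ((d : ℝ) * c, c) ∈ X)
    (hbound : ∀ q ∈ X, c ≤ q.2 ∧ J d * c ≤ q.1 + J (d - 1) * q.2) :
    IsMBRPoint X ((d : ℝ) * c, c) := by
  refine ⟨hmem, fun q hq => ⟨(hbound q hq).1, fun h => ?_⟩⟩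
  have hb := (hbound q hq).2
  dsimp only at h ⊢
  -- As `J d - J (d - 1) = d`, equality in the first bound turns the second into `d * c ≤ q.1`.
  rw [h, J_pred hd] at hb
  linarith

/-- The MBR point of the exact-repair problem. -/
theorem isMBRPoint_regeneratingRegion {n d : ℕ} (hd : 1 ≤ d) (hdn : d < n) (k : Fin d) :
    IsMBRPoint (regeneratingRegion n (k + 1) d) (d * T d (k + 1), T d (k + 1)) := by
  apply isMBRPoint_of_outer_bounds hd
  · obtain ⟨W, S, C, hW, hS, -, -, hbW, hbS⟩ :=
      exists_code_of_bits k (t := n) (by omega) le_rfl rfl Bool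
    refine ⟨_, W, S, C, inferInstance, hW, hS, ?_, hbW.le, hbS.le⟩
    rw [bits_fun]
    refine mul_pos ?_ (bits_pos Bool)
    rw [Nat.cast_mul, cast_messageLength k.2]
    exact mul_pos (by exact_mod_cast (by omega : 0 < n)) (repairCount_succ_pos k.2)
  · rintro q ⟨M, W, S, C, hM, hW, hS, hB, hα, hβ⟩
    obtain ⟨h1, h2⟩ := C.outer_bounds hd hdn
    have hJ : 0 ≤ J (d - 1) := Finset.sum_nonneg fun i _ => Nat.cast_nonneg i
    refine ⟨le_of_mul_le_mul_right (h1.trans hβ) hB, le_of_mul_le_mul_right ?_ hB⟩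
    have := mul_le_mul_of_nonneg_left hβ hJ
    linarith

lemma weightedSize_normalizedSizes {d : ℕ} (M : Fin d → Type) (hB : 0 < ∑ k, bits (M k)) :
    weightedSize (normalizedSizes M) * ∑ k, bits (M k) =
      ∑ k : Fin d, T d (k + 1) * bits (M k) := by
  unfold weightedSize normalizedSizes
  rw [Finset.sum_mul]
  refine Finset.sum_congr rfl fun k _ => ?_
  rw [mul_assoc, div_mul_cancel₀ _ hB.ne']

/-- The outer bounds of the MLDR region. -/
theorem mldrRegion_outer_bounds {n d : ℕ} (hd : 1 ≤ d) (hdn : d < n) {Bbar : Fin d → ℝ}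
    {p : ℝ × ℝ} (hp : p ∈ mldrRegion n d Bbar) :
    weightedSize Bbar ≤ p.2 ∧ J d * weightedSize Bbar ≤ p.1 + J (d - 1) * p.2 := by
  obtain ⟨M, W, S, C, hM, hW, hS, hB, hBbar, hα, hβ⟩ := hp
  have := fun k => (hM k).1
  have := fun k => (hM k).2
  obtain rfl : Bbar = normalizedSizes M := funext hBbar
  obtain ⟨h1, h2⟩ := C.outer_bounds hd hdn
  rw [← weightedSize_normalizedSizes M hB] at h1 h2
  have hJ : 0 ≤ J (d - 1) := Finset.sum_nonneg fun i _ => Nat.cast_nonneg i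
  refine ⟨le_of_mul_le_mul_right (h1.trans hβ) hB, le_of_mul_le_mul_right ?_ hB⟩
  have := mul_le_mul_of_nonneg_left hβ hJ
  linarith

lemma normalizedSizes_block {d s : ℕ} (hs : s ≠ 0) (M : Fin d → Type) (k : Fin d) :
    normalizedSizes (fun k => Fin s → M k) k = normalizedSizes M k := by
  unfold normalizedSizes
  simp only [bits_fun, ← Finset.mul_sum]
  exact mul_div_mul_left _ _ (by exact_mod_cast hs)

/-- Separate coding with codes that meet the single-message MBR values. -/
theorem separateCode_achieves {n d s : ℕ} (hs : s ≠ 0) {M W S : Fin d → Type}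
    [∀ k, Finite (M k)] [∀ k, Nonempty (M k)] [∀ k, Finite (W k)] [∀ k, Nonempty (W k)]
    [∀ k, Finite (S k)] [∀ k, Nonempty (S k)] (hB : 0 < ∑ k, bits (M k))
    (C : ∀ k : Fin d, RegeneratingCode n ((k : ℕ) + 1) d (Fin s → M k) (W k) (S k))
    (hW : ∀ k : Fin d, bits (W k) = d * T d ((k : ℕ) + 1) * bits (Fin s → M k))
    (hS : ∀ k : Fin d, bits (S k) = T d ((k : ℕ) + 1) * bits (Fin s → M k)) :
    (separateCode C).Achieves (normalizedSizes M)
      (d * weightedSize (normalizedSizes M), weightedSize (normalizedSizes M)) := by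
  have hB' : 0 < ∑ k, bits (Fin s → M k) := by
    simp only [bits_fun, ← Finset.mul_sum]
    exact mul_pos (by exact_mod_cast Nat.pos_of_ne_zero hs) hB
  have hnorm : normalizedSizes (fun k => Fin s → M k) = normalizedSizes M :=
    funext (normalizedSizes_block hs M)
  have hw := weightedSize_normalizedSizes (fun k => Fin s → M k) hB'
  rw [hnorm] at hw
  refine ⟨fun k => ⟨inferInstance, inferInstance⟩, inferInstance, inferInstance, hB',
    fun k => (normalizedSizes_block hs M k).symm, le_of_eq ?_, le_of_eq ?_⟩
  · dsimp only
    rw [bits_pi, mul_assoc, hw, Finset.mul_sum]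
    exact Finset.sum_congr rfl fun k _ => by rw [hW k, mul_assoc]
  · dsimp only
    rw [bits_pi, hw]
    exact Finset.sum_congr rfl fun k _ => hS k

/-- A code with the single-message MBR values is an MBR code. -/
lemma RegeneratingCode.isMBR_of_bits {n d : ℕ} (hd : 1 ≤ d) (hdn : d < n) (k : Fin d)
    {M W S : Type} [Finite M] [Finite W] [Finite S] (C : RegeneratingCode n (k + 1) d M W S)
    (hB : 0 < bits M) (hW : bits W = d * T d (k + 1) * bits M) (hS : bits S = T d (k + 1) * bits M) :
    C.IsMBR := by
  have h1 : bits W / bits M = d * T d (k + 1) := by rw [hW, mul_div_cancel_right₀ _ hB.ne']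
  have h2 : bits S / bits M = T d (k + 1) := by rw [hS, mul_div_cancel_right₀ _ hB.ne']
  unfold RegeneratingCode.IsMBR
  rw [h1, h2]
  exact ⟨⟨inferInstance, inferInstance, inferInstance, hB, hW.le, hS.le⟩,
    isMBRPoint_regeneratingRegion hd hdn k⟩

end MLDR

/-! ### The main theorem -/

theorem mainTheorem2 (n d : ℕ) (hd : 1 ≤ d) (hdn : d < n)
    (M : Fin d → Type) (hfin : ∀ k, Finite (M k)) (hne : ∀ k, Nonempty (M k))
    (hM : ∃ k, Nontrivial (M k)) :
    -- separate coding of blocks of `s` messages with MBR codes achieves the pair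
    (∃ s : ℕ, 1 ≤ s ∧ ∃ (W S : Fin d → Type)
      (C : ∀ k : Fin d,
        MLDR.RegeneratingCode n ((k : ℕ) + 1) d (Fin s → M k) (W k) (S k)),
      (∀ k, Finite (W k) ∧ Finite (S k) ∧
        MLDR.bits (W k) = d * MLDR.T d ((k : ℕ) + 1) * MLDR.bits (Fin s → M k) ∧
        MLDR.bits (S k) = MLDR.T d ((k : ℕ) + 1) * MLDR.bits (Fin s → M k)) ∧
      (∀ k, Nontrivial (M k) → (C k).IsMBR) ∧
      (MLDR.separateCode C).Achieves (MLDR.normalizedSizes M)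
        (d * MLDR.weightedSize (MLDR.normalizedSizes M),
          MLDR.weightedSize (MLDR.normalizedSizes M))) ∧
    -- the MBR point of each individual exact-repair problem
    (∀ k : Fin d, MLDR.IsMBRPoint (MLDR.regeneratingRegion n ((k : ℕ) + 1) d)
      (d * MLDR.T d ((k : ℕ) + 1), MLDR.T d ((k : ℕ) + 1))) ∧
    -- the two outer bounds
    (∀ p ∈ MLDR.mldrRegion n d (MLDR.normalizedSizes M),
      MLDR.weightedSize (MLDR.normalizedSizes M) ≤ p.2 ∧
      MLDR.J d * MLDR.weightedSize (MLDR.normalizedSizes M) ≤ p.1 + MLDR.J (d - 1) * p.2) ∧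
    -- the pair is the unique point at which both bounds hold with equality
    (∀ p : ℝ × ℝ,
      (p.2 = MLDR.weightedSize (MLDR.normalizedSizes M) ∧
        p.1 + MLDR.J (d - 1) * p.2 = MLDR.J d * MLDR.weightedSize (MLDR.normalizedSizes M)) ↔
      p = (d * MLDR.weightedSize (MLDR.normalizedSizes M),
        MLDR.weightedSize (MLDR.normalizedSizes M))) ∧
    -- the pair is the MBR point of the MLDR problem
    MLDR.IsMBRPoint (MLDR.mldrRegion n d (MLDR.normalizedSizes M))
      (d * MLDR.weightedSize (MLDR.normalizedSizes M),
        MLDR.weightedSize (MLDR.normalizedSizes M)) := by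
  have hB : 0 < ∑ k, MLDR.bits (M k) := by
    obtain ⟨k, hk⟩ := hM
    exact Finset.sum_pos' (fun k _ => MLDR.bits_nonneg _) ⟨k, Finset.mem_univ k, MLDR.bits_pos _⟩
  have hlen : ∀ k : Fin d, MLDR.messageLength (k + 1) d ≠ 0 := fun k h => by
    have h' := MLDR.cast_messageLength (k := k + 1) k.2
    rw [h, Nat.cast_zero] at h'
    exact (MLDR.repairCount_succ_pos k.2).ne h'
  -- One block length for all levels: each message length divides `s`, and the factor `n` keeps the
  -- exponent `t` of every level at least `n`.
  set s : ℕ := n * ∏ k : Fin d, MLDR.messageLength (k + 1) d with hs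
  have hn : n ≠ 0 := by omega
  have hs0 : s ≠ 0 := mul_ne_zero hn (Finset.prod_ne_zero_iff.mpr fun k _ => hlen k)
  have hcode : ∀ k : Fin d, ∃ (W S : Type)
      (_ : MLDR.RegeneratingCode n ((k : ℕ) + 1) d (Fin s → M k) W S),
      Finite W ∧ Finite S ∧ Nonempty W ∧ Nonempty S ∧
      MLDR.bits W = d * MLDR.T d (k + 1) * MLDR.bits (Fin s → M k) ∧
      MLDR.bits S = MLDR.T d (k + 1) * MLDR.bits (Fin s → M k) := by
    intro k
    have hprod : ∏ l ∈ Finset.univ.erase k, MLDR.messageLength (l + 1) d ≠ 0 :=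
      Finset.prod_ne_zero_iff.mpr fun l _ => hlen l
    refine MLDR.exists_code_of_bits k
      (t := n * ∏ l ∈ Finset.univ.erase k, MLDR.messageLength (l + 1) d)
      (mul_ne_zero hn hprod) (Nat.le_mul_of_pos_right _ (Nat.pos_of_ne_zero hprod)) ?_ (M k)
    rw [hs, mul_assoc, Finset.prod_erase_mul _ _ (Finset.mem_univ k)]
  choose W S C hWf hSf hWn hSn hW hS using hcode
  have hach := MLDR.separateCode_achieves hs0 hB C hW hS
  refine ⟨⟨s, Nat.one_le_iff_ne_zero.mpr hs0, W, S, C,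
      fun k => ⟨hWf k, hSf k, hW k, hS k⟩, fun k hk => ?_, hach⟩,
    MLDR.isMBRPoint_regeneratingRegion hd hdn,
    fun p hp => MLDR.mldrRegion_outer_bounds hd hdn hp, fun p => ?_,
    MLDR.isMBRPoint_of_outer_bounds hd ⟨_, _, _, _, hach⟩
      fun q hq => MLDR.mldrRegion_outer_bounds hd hdn hq⟩
  · refine (C k).isMBR_of_bits hd hdn k ?_ (hW k) (hS k)
    rw [MLDR.bits_fun]
    exact mul_pos (by exact_mod_cast Nat.pos_of_ne_zero hs0) (MLDR.bits_pos _)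
  · rw [MLDR.J_pred hd, Prod.ext_iff]
    constructor
    · rintro ⟨h1, h2⟩
      rw [h1] at h2
      exact ⟨by linarith, h1⟩
    · rintro ⟨h1, h2⟩
      dsimp only at h1 h2
      rw [h1, h2]
      exact ⟨rfl, by ring⟩
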